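/- Let the torus $\mathbb{T}^n = U(1)^n$ act on the complex manifold $(\mathbb{C}^*)^n$ by coordinatewise multiplication, and let $\omega$ be a (smooth) Kähler form on $(\mathbb{C}^*)^n$ such that this action is Hamiltonian, i.e. there is a $\mathbb{T}^n$-invariant moment map $\mu : (\mathbb{C}^*)^n \to (\mathbb{R}^n)^*$ with $d\langle \mu, X\rangle = \iota_{\tilde X}\omega$ for every $X \in \mathbb{R}^n = \mathrm{Lie}(\mathbb{T}^n)$, where $\tilde X_z = (i X_j z_j)_j$ is the fundamental vector field of $X$. Let $J$ denote multiplication by $i$, $g(u,v) = \omega(u, Jv)$ the Riemannian metric, $h = g - i\omega$ the Hermitian metric, $\mathrm{Ric}$ the Ricci tensor of $g$, and $H = \det\big(h(\tilde X_i, \tilde X_j)\big)_{i,j}$ for the standard basis $X_1,\dots,X_n$ of $\mathbb{R}^n$. Identify the orbit space $(\mathbb{C}^*)^n/\mathbb{T}^n$ with $\mathbb{R}^n$, where $x \in \mathbb{R}^n$ corresponds to the orbit of $(e^{x_1},\dots,e^{x_n})$, and let $\mathrm{Vol}(x)$ be the $n$-dimensional Riemannian volume, with respect to $g$, of this orbit.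 Then $H$ is $\mathbb{T}^n$-invariant, $\mathrm{Vol}$ is a well-defined positive function on the orbit space, and: 1. $\mathrm{Ric} \le 0$ on $(\mathbb{C}^*)^n$ if and only if $\log \mathrm{Vol}$ is convex on $\mathbb{R}^n$; in this case $\mathrm{Vol}$ is convex. 2. $\mathrm{Ric} \ge 0$ on $(\mathbb{C}^*)^n$ if and only if $\log \mathrm{Vol}$ is concave on $\mathbb{R}^n$; in this case $1/\mathrm{Vol}$ is convex. 3. If $\mathrm{Ric} = 0$, then $\log\mathrm{Vol}$ is an affine function on $\mathbb{R}^n$; thus for all $x, v \in \mathbb{R}^n$ there is $a \in \mathbb{R}$ such that, for all $s \in \mathbb{R}$, $\log\mathrm{Vol}(x + s v) = \log\mathrm{Vol}(x) + a s$ and $\mathrm{Vol}(x+sv) = \mathrm{Vol}(x)\, e^{a s}$. -/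

import Mathlib

set_option maxSynthPendingDepth 3

noncomputable section

namespace ToricKahler

/-! ### Riemannian geometry in a chart -/

section Riemannian

variable {E : Type*} [NormedAddCommGroup E] [NormedSpace ℝ E]

/-- The first-kind Christoffel symbols of a metric tensor `g` given on an open subset of `E`:
`Γ(u, v; w) = 1/2 (∂_u g(v, w) + ∂_v g(u, w) - ∂_w g(u, v))`. -/
def koszul (g : E → E →L[ℝ] E →L[ℝ] ℝ) (p : E) : E →L[ℝ] E →L[ℝ] E →L[ℝ] ℝ :=
  (1 / 2 : ℝ) • (fderiv ℝ g p + (fderiv ℝ g p).flip -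
    ((ContinuousLinearMap.flipₗᵢ ℝ E E ℝ).toContinuousLinearEquiv :
      (E →L[ℝ] E →L[ℝ] ℝ) →L[ℝ] (E →L[ℝ] E →L[ℝ] ℝ)).comp (fderiv ℝ g p).flip)

theorem koszul_apply (g : E → E →L[ℝ] E →L[ℝ] ℝ) (p u v w : E) :
    koszul g p u v w =
      (1 / 2) * (fderiv ℝ g p u v w + fderiv ℝ g p v u w - fderiv ℝ g p w u v) := by
  simp [koszul]

/-- The Christoffel symbols `Γ(u, v)` of the Levi-Civita connection of `g`, so that
`∇_X Y = D_X Y + Γ(X, Y)`: the first-kind symbols with the last index raised by the inverse of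
`g p : E → E*`. -/
def christoffel (g : E → E →L[ℝ] E →L[ℝ] ℝ) (p : E) : E →L[ℝ] E →L[ℝ] E :=
  (ContinuousLinearMap.compL ℝ E (E →L[ℝ] ℝ) E (ContinuousLinearMap.inverse (g p))).comp
    (koszul g p)

theorem christoffel_apply (g : E → E →L[ℝ] E →L[ℝ] ℝ) (p u v : E) :
    christoffel g p u v = ContinuousLinearMap.inverse (g p) (koszul g p u v) := by
  simp [christoffel]

/-- The linear map `u ↦ R(u, v) w`, where `R(u, v) w = ∇_u ∇_v w - ∇_v ∇_u w` (for constant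
vector fields `u, v, w`) is the curvature tensor of the Levi-Civita connection. -/
def curvature (g : E → E →L[ℝ] E →L[ℝ] ℝ) (p v w : E) : E →L[ℝ] E :=
  ((fderiv ℝ (christoffel g) p).flip v).flip w - (fderiv ℝ (christoffel g) p v).flip w
    + (christoffel g p).flip (christoffel g p v w)
    - (christoffel g p v).comp ((christoffel g p).flip w)

theorem curvature_apply (g : E → E →L[ℝ] E →L[ℝ] ℝ) (p u v w : E) :
    curvature g p v w u =
      fderiv ℝ (christoffel g) p u v w - fderiv ℝ (christoffel g) p v u w
        + christoffel g p u (christoffel g p v w) - christoffel g p v (christoffel g p u w) := by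
  simp [curvature]

/-- The Ricci tensor `Ric(v, w) = tr (u ↦ R(u, v) w)` of the metric `g`. -/
def ricci (g : E → E →L[ℝ] E →L[ℝ] ℝ) (p v w : E) : ℝ :=
  LinearMap.trace ℝ E (curvature g p v w : E →ₗ[ℝ] E)

/-- The Riemannian `n`-dimensional volume, with respect to `g`, of a submanifold parametrized
by `γ : D → E` with `D ⊆ ℝⁿ`. -/
def paramVolume {n : ℕ} (g : E → E →L[ℝ] E →L[ℝ] ℝ) (D : Set (Fin n → ℝ))
    (γ : (Fin n → ℝ) → E) : ℝ :=
  ∫ θ in D, Real.sqrt (Matrix.det (Matrix.of fun i j : Fin n =>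
    g (γ θ) (fderiv ℝ γ θ (Pi.single i 1)) (fderiv ℝ γ θ (Pi.single j 1))))

/-- A `2`-form at a point, as a bilinear map. -/
def formToBilin (ω : E [⋀^Fin 2]→L[ℝ] ℝ) : E →L[ℝ] E →L[ℝ] ℝ :=
  ((continuousMultilinearCurryFin1 ℝ E ℝ).toContinuousLinearEquiv :
    (E [×1]→L[ℝ] ℝ) →L[ℝ] (E →L[ℝ] ℝ)).comp ω.toContinuousMultilinearMap.curryLeft

theorem formToBilin_apply (ω : E [⋀^Fin 2]→L[ℝ] ℝ) (u v : E) :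
    formToBilin ω u v = ω ![u, v] := by
  simp [formToBilin]

end Riemannian

/-! ### The complex torus and the action of the compact torus -/

variable {n : ℕ}

/-- `(ℂ*)ⁿ` as an open subset of `ℂⁿ`. -/
def cstar (n : ℕ) : Set (Fin n → ℂ) := {z | ∀ j, z j ≠ 0}

/-- The action of the torus `𝕋ⁿ = U(1)ⁿ` on `ℂⁿ` by coordinatewise multiplication. -/
def torusAct (t : Fin n → Circle) (z : Fin n → ℂ) : Fin n → ℂ := fun j => (t j : ℂ) * z j

/-- The exponential map from the Lie algebra `ℝⁿ` of `𝕋ⁿ`. -/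
def torusExp (θ : Fin n → ℝ) : Fin n → Circle := fun j => Circle.exp (θ j)

/-- The fundamental vector field on `(ℂ*)ⁿ` of the element `X` of the Lie algebra of `𝕋ⁿ`. -/
def fundField (X : Fin n → ℝ) (z : Fin n → ℂ) : Fin n → ℂ :=
  fun j => (X j : ℂ) * Complex.I * z j

theorem hasDerivAt_fundField (X : Fin n → ℝ) (z : Fin n → ℂ) :
    HasDerivAt (fun s : ℝ => torusAct (torusExp (s • X)) z) (fundField X z) 0 := by
  rw [hasDerivAt_pi]
  intro j
  have h1 : HasDerivAt (fun s : ℝ => ((s * X j : ℝ) : ℂ) * Complex.I)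
      ((X j : ℂ) * Complex.I) 0 := by
    have h := ((hasDerivAt_id (0 : ℝ)).mul_const (X j)).ofReal_comp.mul_const Complex.I
    simpa using h
  have h2 := (h1.cexp).mul_const (z j)
  simpa [torusAct, torusExp, fundField, Circle.coe_exp] using h2

/-- The point `exp(x)` of `(ℂ*)ⁿ`. -/
def expPoint (x : Fin n → ℝ) : Fin n → ℂ := fun j => Complex.exp (x j : ℂ)

/-- Each torus orbit in `(ℂ*)ⁿ` contains exactly one point `exp(x)` with `x ∈ ℝⁿ`; this is the
identification of the orbit space with `ℝⁿ`. -/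
theorem existsUnique_expPoint (z : Fin n → ℂ) (hz : z ∈ cstar n) :
    ∃! x : Fin n → ℝ, ∃ t : Fin n → Circle, torusAct t (expPoint x) = z := by
  refine ⟨fun j => Real.log ‖z j‖, ⟨fun j => Circle.exp (Complex.arg (z j)), ?_⟩, ?_⟩
  · funext j
    have h : (0 : ℝ) < ‖z j‖ := norm_pos_iff.mpr (hz j)
    simp only [torusAct, expPoint, Circle.coe_exp]
    rw [← Complex.ofReal_exp, Real.exp_log h, mul_comm]
    exact Complex.norm_mul_exp_arg_mul_I (z j)
  · rintro y ⟨t, ht⟩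
    funext j
    have h : z j = (t j : ℂ) * Complex.exp (y j : ℂ) := (congrFun ht j).symm
    rw [h, norm_mul, Circle.norm_coe, one_mul, ← Complex.ofReal_exp, Complex.norm_real,
      Real.norm_eq_abs, Real.abs_exp, Real.log_exp]

/-! ### Kähler forms, moment maps and volumes of orbits -/

/-- `ω` is a Kähler form on `(ℂ*)ⁿ` with its standard complex structure: a smooth closed real
`(1,1)`-form (that is, a `2`-form invariant under multiplication by `i`) which is positive. -/
structure IsKahlerForm (ω : (Fin n → ℂ) → (Fin n → ℂ) [⋀^Fin 2]→L[ℝ] ℝ) : Prop where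
  smooth : ContDiffOn ℝ ((⊤ : ℕ∞) : WithTop ℕ∞) ω (cstar n)
  closed : ∀ z ∈ cstar n, extDeriv ω z = 0
  compatible : ∀ z ∈ cstar n, ∀ u v : Fin n → ℂ,
    ω z ![Complex.I • u, Complex.I • v] = ω z ![u, v]
  positive : ∀ z ∈ cstar n, ∀ v : Fin n → ℂ, v ≠ 0 → 0 < ω z ![v, Complex.I • v]

/-- `μ` is a moment map for the torus action on `(ℂ*)ⁿ`: `d(μ·X) = ι_X̃ ω` and `μ` is
equivariant for the coadjoint action, which is trivial since the torus is Abelian. -/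
structure IsMomentMap (ω : (Fin n → ℂ) → (Fin n → ℂ) [⋀^Fin 2]→L[ℝ] ℝ)
    (μ : (Fin n → ℂ) → (Fin n → ℝ) →L[ℝ] ℝ) : Prop where
  differentiableAt : ∀ z ∈ cstar n, DifferentiableAt ℝ μ z
  fderiv_eq : ∀ X : Fin n → ℝ, ∀ z ∈ cstar n, ∀ v : Fin n → ℂ,
    fderiv ℝ (fun y => μ y X) z v = ω z ![fundField X z, v]
  equivariant : ∀ t : Fin n → Circle, ∀ z ∈ cstar n, μ (torusAct t z) = μ z

/-- The torus action on `((ℂ*)ⁿ, ω)` is Hamiltonian. -/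
def IsHamiltonian (ω : (Fin n → ℂ) → (Fin n → ℂ) [⋀^Fin 2]→L[ℝ] ℝ) : Prop :=
  ∃ μ : (Fin n → ℂ) → (Fin n → ℝ) →L[ℝ] ℝ, IsMomentMap ω μ

/-- The Riemannian metric `g(u, v) = ω(u, Jv)` of a Kähler form. -/
def kahlerMetric (ω : (Fin n → ℂ) → (Fin n → ℂ) [⋀^Fin 2]→L[ℝ] ℝ) (z : Fin n → ℂ) :
    (Fin n → ℂ) →L[ℝ] (Fin n → ℂ) →L[ℝ] ℝ :=
  (formToBilin (ω z)).bilinearComp (ContinuousLinearMap.id ℝ (Fin n → ℂ))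
    (Complex.I • ContinuousLinearMap.id ℝ (Fin n → ℂ))

theorem kahlerMetric_apply (ω : (Fin n → ℂ) → (Fin n → ℂ) [⋀^Fin 2]→L[ℝ] ℝ)
    (z u v : Fin n → ℂ) : kahlerMetric ω z u v = ω z ![u, Complex.I • v] := by
  simp [kahlerMetric, formToBilin_apply]

/-- The Hermitian metric `h = g - iω`, complex linear in its first argument. -/
def kahlerHermitian (ω : (Fin n → ℂ) → (Fin n → ℂ) [⋀^Fin 2]→L[ℝ] ℝ) (z u v : Fin n → ℂ) : ℂ :=
  (kahlerMetric ω z u v : ℂ) - Complex.I * (ω z ![u, v] : ℂ)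

/-- `H = det h(X̃_i, X̃_j)`, for the standard basis `X_i` of the Lie algebra of the torus. -/
def detH (ω : (Fin n → ℂ) → (Fin n → ℂ) [⋀^Fin 2]→L[ℝ] ℝ) (z : Fin n → ℂ) : ℂ :=
  Matrix.det (Matrix.of fun i j : Fin n =>
    kahlerHermitian ω z (fundField (Pi.single i 1) z) (fundField (Pi.single j 1) z))

/-- The cube `[0, 2π)ⁿ`. -/
def angleBox (n : ℕ) : Set (Fin n → ℝ) :=
  Set.univ.pi fun _ => Set.Ico 0 (2 * Real.pi)

/-- `θ ↦ exp(θ) · z` parametrizes the orbit of `z` bijectively by `[0, 2π)ⁿ`. -/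
theorem bijOn_orbit (z : Fin n → ℂ) (hz : z ∈ cstar n) :
    Set.BijOn (fun θ => torusAct (torusExp θ) z) (angleBox n)
      (Set.range fun t : Fin n → Circle => torusAct t z) := by
  refine ⟨fun θ _ => ⟨torusExp θ, rfl⟩, ?_, ?_⟩
  · intro a ha b hb hab
    funext j
    have h : ((Circle.exp (a j) : Circle) : ℂ) * z j = (Circle.exp (b j) : ℂ) * z j :=
      congrFun hab j
    have h' : Circle.exp (a j) = Circle.exp (b j) := Circle.ext (mul_right_cancel₀ (hz j) h)
    obtain ⟨m, hm⟩ := Circle.exp_eq_exp.mp h'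
    have ha' := ha j trivial
    have hb' := hb j trivial
    simp only [Set.mem_Ico] at ha' hb'
    have hpi := Real.pi_pos
    have hm0 : m = 0 := by
      have h1 : (m : ℝ) < 1 := by nlinarith
      have h2 : (-1 : ℝ) < m := by nlinarith
      have h1' : m < 1 := by exact_mod_cast h1
      have h2' : -1 < m := by exact_mod_cast h2
      omega
    simpa [hm0] using hm
  · rintro _ ⟨t, rfl⟩
    refine ⟨fun j => toIcoMod Real.two_pi_pos 0 (Complex.arg (t j)), ?_, ?_⟩
    · intro j _
      simpa using toIcoMod_mem_Ico Real.two_pi_pos 0 (Complex.arg (t j))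
    · funext j
      have : Circle.exp (toIcoMod Real.two_pi_pos 0 (Complex.arg (t j))) = t j := by
        rw [toIcoMod, zsmul_eq_mul, Circle.periodic_exp.sub_int_mul_eq, Circle.exp_arg]
      simp [torusAct, torusExp, this]

/-- The Riemannian volume of the torus orbit through `z`. -/
def orbitVolume (ω : (Fin n → ℂ) → (Fin n → ℂ) [⋀^Fin 2]→L[ℝ] ℝ) (z : Fin n → ℂ) : ℝ :=
  paramVolume (kahlerMetric ω) (angleBox n) fun θ => torusAct (torusExp θ) z

/-- The volume functional on the orbit space `(ℂ*)ⁿ / 𝕋ⁿ ≃ ℝⁿ`, where `x ∈ ℝⁿ` corresponds to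
the orbit of `exp(x)`. -/
def vol (ω : (Fin n → ℂ) → (Fin n → ℂ) [⋀^Fin 2]→L[ℝ] ℝ) (x : Fin n → ℝ) : ℝ :=
  orbitVolume ω (expPoint x)

end ToricKahler

end

/-!
In linear coordinates the Ricci tensor of a Kähler metric is `-1/2` times the Levi form
`φ ↦ D²φ(v, w) + D²φ(Jv, Jw)` of the logarithm `φ` of the Riemannian volume density. Since the
moment map is invariant, the torus orbits are isotropic, so every `X̃ⱼ` is orthogonal to every
`i X̃ₖ`: the Gram determinant of the real frame `X̃ᵢ, i X̃ᵢ` is the square of that of the `X̃ᵢ`,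
whose square root is, up to the constant `(2π)ⁿ`, the volume of the orbit. As `X̃ⱼ = i zⱼ ∂ⱼ`, the
log density at `z` is `2 log Vol(log |z|) - 2 ∑ log |zⱼ|` up to a constant. The functions
`log |zⱼ|` are pluriharmonic, hence `Ric` at `z` is minus the sum of the pullbacks of the Hessian of
`log Vol` along `v ↦ Re (v / z)` and `v ↦ Re (i v / z)`; at `z = exp x` the vectors `v = a z` with
`a` real recover the whole Hessian.
-/

namespace ToricKahler

open scoped Kronecker Matrix Topology

/-! ### Hessians -/

section Hessian

variable {E F : Type*} [NormedAddCommGroup E] [NormedSpace ℝ E] [NormedAddCommGroup F]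
  [NormedSpace ℝ F] {f : E → ℝ}

theorem hasDerivAt_line (x v : E) (s : ℝ) : HasDerivAt (fun t : ℝ => x + t • v) v s := by
  simpa using ((hasDerivAt_id s).smul_const v).const_add x

theorem hasDerivAt_comp_line {f : E → F} {x v : E} {s : ℝ}
    (hf : DifferentiableAt ℝ f (x + s • v)) :
    HasDerivAt (fun t : ℝ => f (x + t • v)) (fderiv ℝ f (x + s • v) v) s :=
  hf.hasFDerivAt.comp_hasDerivAt s (hasDerivAt_line x v s)

theorem hasDerivAt_fderiv_comp_line (hf : ContDiff ℝ 2 f) (x v : E) (s : ℝ) :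
    HasDerivAt (fun t : ℝ => fderiv ℝ f (x + t • v) v)
      (fderiv ℝ (fderiv ℝ f) (x + s • v) v v) s := by
  have hd : Differentiable ℝ (fderiv ℝ f) :=
    (hf.fderiv_right (m := 1) (by norm_num)).differentiable one_ne_zero
  simpa using (hasDerivAt_comp_line (hd (x + s • v))).clm_apply (hasDerivAt_const s v)

theorem convexOn_univ_iff_comp_line :
    ConvexOn ℝ Set.univ f ↔ ∀ x v : E, ConvexOn ℝ Set.univ fun s : ℝ => f (x + s • v) := by
  have hline (x v : E) (s : ℝ) : AffineMap.lineMap x (x + v) s = x + s • v := by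
    simp [AffineMap.lineMap_apply, add_comm]
  refine ⟨fun h x v => ?_, fun h => ⟨convex_univ, fun x _ y _ a b ha hb hab => ?_⟩⟩
  · simpa [Function.comp_def, hline] using h.comp_affineMap (AffineMap.lineMap x (x + v))
  · have hcombo : x + b • (y - x) = a • x + b • y := by rw [eq_sub_of_add_eq hab]; module
    simpa [hcombo] using (h x (y - x)).2 (Set.mem_univ 0) (Set.mem_univ 1) ha hb hab

theorem convexOn_univ_iff_hessian_nonneg (hf : ContDiff ℝ 2 f) :
    ConvexOn ℝ Set.univ f ↔ ∀ x v, 0 ≤ fderiv ℝ (fderiv ℝ f) x v v := by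
  have hline (x v : E) (s : ℝ) : HasDerivAt (fun t : ℝ => f (x + t • v)) _ s :=
    hasDerivAt_comp_line (hf.differentiable two_ne_zero _)
  have hderiv (x v : E) : deriv (fun s : ℝ => f (x + s • v)) = fun s => fderiv ℝ f (x + s • v) v :=
    funext fun s => (hline x v s).deriv
  have hderiv2 := hasDerivAt_fderiv_comp_line hf
  rw [convexOn_univ_iff_comp_line]
  refine ⟨fun h x v => ?_, fun h x v => ?_⟩
  · have hmono := (h x v).monotoneOn_deriv fun s _ => (hline x v s).differentiableAt
    rw [hderiv, monotoneOn_univ] at hmono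
    simpa [(hderiv2 x v 0).deriv] using hmono.deriv_nonneg (x := 0)
  · refine convexOn_univ_of_deriv2_nonneg (fun s => (hline x v s).differentiableAt) ?_ fun s => ?_
    · rw [hderiv]
      exact fun s => (hderiv2 x v s).differentiableAt
    · rw [Function.iterate_succ, Function.iterate_one, Function.comp_apply, hderiv,
        (hderiv2 x v s).deriv]
      exact h _ _

theorem concaveOn_univ_iff_hessian_nonpos (hf : ContDiff ℝ 2 f) :
    ConcaveOn ℝ Set.univ f ↔ ∀ x v, fderiv ℝ (fderiv ℝ f) x v v ≤ 0 := by
  have hneg : fderiv ℝ (-f) = -fderiv ℝ f := funext fun _ => fderiv_neg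
  rw [← neg_convexOn_iff, convexOn_univ_iff_hessian_nonneg (f := -f) hf.neg]
  simp [hneg, fderiv_neg]

theorem eq_add_fderiv_of_hessian_eq_zero (hf : ContDiff ℝ 2 f)
    (h : ∀ x, fderiv ℝ (fderiv ℝ f) x = 0) (x : E) : f x = f 0 + fderiv ℝ f 0 x := by
  have hd : Differentiable ℝ f := hf.differentiable two_ne_zero
  have hd' : Differentiable ℝ (fderiv ℝ f) :=
    (hf.fderiv_right (m := 1) (by norm_num)).differentiable one_ne_zero
  have hconst (y : E) : fderiv ℝ f y = fderiv ℝ f 0 := is_const_of_fderiv_eq_zero hd' h y 0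
  have hremainder := is_const_of_fderiv_eq_zero (hd.sub (fderiv ℝ f 0).differentiable)
    (fun y => by
      rw [fderiv_sub (hd y) (fderiv ℝ f 0).differentiableAt, ContinuousLinearMap.fderiv, hconst,
        sub_self]) x 0
  simpa [sub_eq_iff_eq_add] using hremainder

theorem fderiv_fderiv_const_mul_add_affine (hf : ContDiff ℝ 2 f) (c d : ℝ) (l : E →L[ℝ] ℝ)
    (x : E) :
    fderiv ℝ (fderiv ℝ fun y => c * f y + (l y + d)) x = c • fderiv ℝ (fderiv ℝ f) x := by
  have hd' : Differentiable ℝ (fderiv ℝ f) :=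
    (hf.fderiv_right (m := 1) (by norm_num)).differentiable one_ne_zero
  have hfirst : (fderiv ℝ fun y => c * f y + (l y + d)) = fun y => c • fderiv ℝ f y + l :=
    funext fun y => (((hf.differentiable two_ne_zero y).hasFDerivAt.const_mul c).add
      (l.hasFDerivAt.add_const d)).fderiv
  rw [hfirst, fderiv_add_const, fderiv_fun_const_smul (hd' x)]

theorem fderiv_clm_apply_apply {G H : Type*} [NormedAddCommGroup G] [NormedSpace ℝ G]
    [NormedAddCommGroup H] [NormedSpace ℝ H] {T : E → F →L[ℝ] G →L[ℝ] H} {p : E}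
    (hT : DifferentiableAt ℝ T p) (u : E) (v : F) (w : G) :
    fderiv ℝ (fun q => T q v w) p u = fderiv ℝ T p u v w := by
  rw [((hT.hasFDerivAt.clm_apply (hasFDerivAt_const v p)).clm_apply (hasFDerivAt_const w p)).fderiv]
  simp

theorem fderiv_fderiv_comp {G : Type*} [NormedAddCommGroup G] [NormedSpace ℝ G] {f : F → G}
    {L : E → F} {p : E} (hf : ContDiffAt ℝ 2 f (L p)) (hL : ContDiffAt ℝ 2 L p) (v w : E) :
    fderiv ℝ (fderiv ℝ (f ∘ L)) p v w =
      fderiv ℝ (fderiv ℝ f) (L p) (fderiv ℝ L p v) (fderiv ℝ L p w)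
        + fderiv ℝ f (L p) (fderiv ℝ (fderiv ℝ L) p v w) := by
  have hchain : fderiv ℝ (f ∘ L) =ᶠ[𝓝 p] fun q => ((fderiv ℝ f ∘ L) q).comp (fderiv ℝ L q) := by
    filter_upwards [hL.eventually (by simp),
      hL.continuousAt.eventually (hf.eventually (by simp))] with q hLq hfq
    exact fderiv_comp q (hfq.differentiableAt two_ne_zero) (hLq.differentiableAt two_ne_zero)
  have hf' : DifferentiableAt ℝ (fderiv ℝ f) (L p) :=
    (hf.fderiv_right (m := 1) (by norm_num)).differentiableAt one_ne_zero
  have hL' : DifferentiableAt ℝ (fderiv ℝ L) p :=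
    (hL.fderiv_right (m := 1) (by norm_num)).differentiableAt one_ne_zero
  have hproduct := (hf'.hasFDerivAt.comp p
    (hL.differentiableAt two_ne_zero).hasFDerivAt).clm_comp hL'.hasFDerivAt
  rw [hchain.fderiv_eq, hproduct.fderiv]
  simp [add_comm]

end Hessian

theorem convexOn_exp_comp {E : Type*} [AddCommGroup E] [Module ℝ E] {s : Set E} {f : E → ℝ}
    (hf : ConvexOn ℝ s f) : ConvexOn ℝ s fun x => Real.exp (f x) :=
  ⟨hf.1, fun _ hx _ hy _ _ ha hb hab => (Real.exp_le_exp.2 (hf.2 hx hy ha hb hab)).trans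
    (convexOn_exp.2 trivial trivial ha hb hab)⟩

/-! ### Determinants, traces and Gram matrices -/

section Determinant

variable {𝕜 E ι : Type*} [NontriviallyNormedField 𝕜] [NormedAddCommGroup E] [NormedSpace 𝕜 E]
  [Fintype ι] [DecidableEq ι] {M : E → Matrix ι ι 𝕜} {p : E}

theorem contDiffAt_det {k : WithTop ℕ∞} (hM : ∀ i j, ContDiffAt 𝕜 k (fun q => M q i j) p) :
    ContDiffAt 𝕜 k (fun q => (M q).det) p := by
  simp only [Matrix.det_apply']
  exact ContDiffAt.sum fun σ _ => contDiffAt_const.mul (contDiffAt_prod fun i _ => hM _ _)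

theorem fderiv_det (hM : ∀ i j, DifferentiableAt 𝕜 (fun q => M q i j) p) (v : E) :
    fderiv 𝕜 (fun q => (M q).det) p v =
      ((M p).adjugate * Matrix.of fun i j => fderiv 𝕜 (fun q => M q i j) p v).trace := by
  let D : ContinuousMultilinearMap 𝕜 (fun _ : ι => ι → 𝕜) 𝕜 :=
    { (Matrix.detRowAlternating : (ι → 𝕜) [⋀^ι]→ₗ[𝕜] 𝕜).toMultilinearMap with
      cont := Continuous.matrix_det (A := fun x : ι → ι → 𝕜 => x) continuous_id }
  have hrow (i : ι) : HasFDerivAt (fun q => M q i)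
      (ContinuousLinearMap.pi fun j => fderiv 𝕜 (fun q => M q i j) p) p :=
    hasFDerivAt_pi.2 fun j => (hM i j).hasFDerivAt
  have hdet : HasFDerivAt (fun q => (M q).det) _ p := HasFDerivAt.multilinear_comp D hrow
  have hcramer (i : ι) (w : ι → 𝕜) : ((M p).updateRow i w).det = (w ᵥ* (M p).adjugate) i := by
    rw [← Matrix.cramer_transpose_apply, Matrix.cramer_eq_adjugate_mulVec,
      ← Matrix.adjugate_transpose, Matrix.mulVec_transpose]
  rw [hdet.fderiv, Matrix.trace_mul_comm, Matrix.trace, sum_apply]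
  exact Finset.sum_congr rfl fun i _ => hcramer i _

end Determinant

section Trace

variable {E : Type*} [NormedAddCommGroup E] [NormedSpace ℝ E] [FiniteDimensional ℝ E]

/-- The trace of a continuous endomorphism, as a continuous linear functional. -/
noncomputable def traceCLM (E : Type*) [NormedAddCommGroup E] [NormedSpace ℝ E]
    [FiniteDimensional ℝ E] : (E →L[ℝ] E) →L[ℝ] ℝ :=
  LinearMap.toContinuousLinearMap ((LinearMap.trace ℝ E).comp (ContinuousLinearMap.coeLM ℝ))

theorem traceCLM_apply (A : E →L[ℝ] E) :
    traceCLM E A = LinearMap.trace ℝ E (A : E →ₗ[ℝ] E) := rfl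

theorem traceCLM_eq_zero_of_anticommute {J A : E →L[ℝ] E} (hJ : ∀ u, J (J u) = -u)
    (hA : ∀ u, A (J u) = -J (A u)) : traceCLM E A = 0 := by
  have hconj : A = J.comp (A.comp J) := by
    ext u
    simp [hA, hJ]
  have hcomm : traceCLM E (J.comp (A.comp J)) = traceCLM E ((A.comp J).comp J) :=
    LinearMap.trace_mul_comm ℝ (J : E →ₗ[ℝ] E) (A.comp J : E →ₗ[ℝ] E)
  have hneg : (A.comp J).comp J = -A := by
    ext u
    simp [hJ]
  rw [← hconj, hneg, map_neg] at hcomm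
  linarith

end Trace

section Gram

variable {E : Type*} [NormedAddCommGroup E] [NormedSpace ℝ E] {ι : Type*}
  (B : E →L[ℝ] E →L[ℝ] ℝ)

/-- The Gram matrix `B(bᵢ, bⱼ)` of a family of vectors with respect to a bilinear form. The
family need not be a basis, so that it applies to the tangent frame of a submanifold. -/
noncomputable def gramMatrix (b : ι → E) : Matrix ι ι ℝ := Matrix.of fun i j => B (b i) (b j)

theorem gramMatrix_apply (b : ι → E) (i j : ι) : gramMatrix B b i j = B (b i) (b j) := rfl

variable {B} in
theorem posDef_gramMatrix [Finite ι] (hsymm : ∀ u v, B u v = B v u) (hpos : ∀ v, v ≠ 0 → 0 < B v v)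
    {b : ι → E} (hb : LinearIndependent ℝ b) : (gramMatrix B b).PosDef := by
  cases nonempty_fintype ι
  refine Matrix.PosDef.of_dotProduct_mulVec_pos ?_ fun c hc => ?_
  · ext i j
    simpa [gramMatrix_apply] using hsymm _ _
  · have hquadratic : star c ⬝ᵥ (gramMatrix B b) *ᵥ c = B (∑ i, c i • b i) (∑ i, c i • b i) := by
      simp only [dotProduct, Matrix.mulVec, gramMatrix_apply, map_sum, map_smul, sum_apply,
        smul_apply, star_trivial, smul_eq_mul, Finset.mul_sum]
      rw [Finset.sum_comm]
      exact Finset.sum_congr rfl fun i _ => Finset.sum_congr rfl fun j _ => by ring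
    rw [hquadratic]
    exact hpos _ fun hsum => hc (funext (Fintype.linearIndependent_iff.1 hb c hsum))

variable [Fintype ι] [DecidableEq ι]

theorem toMatrix₂_eq_gramMatrix (b : Module.Basis ι ℝ E) :
    LinearMap.toMatrix₂ b b B.toLinearMap₁₂ = gramMatrix B b := by
  ext i j
  simp [gramMatrix_apply]

theorem toMatrix_transpose_mul_gramMatrix (b : Module.Basis ι ℝ E) (A : E →L[ℝ] E) :
    (LinearMap.toMatrix b b A)ᵀ * gramMatrix B b = Matrix.of fun i j => B (A (b i)) (b j) := by
  rw [← toMatrix₂_eq_gramMatrix, ← LinearMap.toMatrix₂_comp]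
  ext i j
  simp

theorem gramMatrix_mul_toMatrix (b : Module.Basis ι ℝ E) (A : E →L[ℝ] E) :
    gramMatrix B b * LinearMap.toMatrix b b A = Matrix.of fun i j => B (b i) (A (b j)) := by
  rw [← toMatrix₂_eq_gramMatrix, ← LinearMap.toMatrix₂_compl₂]
  ext i j
  simp

theorem det_gramMatrix_comp (b : Module.Basis ι ℝ E) (A : E →L[ℝ] E) :
    (gramMatrix B (A ∘ b)).det = LinearMap.det (A : E →ₗ[ℝ] E) ^ 2 * (gramMatrix B b).det := by
  have hcongr : gramMatrix B (A ∘ b) =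
      (LinearMap.toMatrix b b A)ᵀ * gramMatrix B b * LinearMap.toMatrix b b A := by
    rw [← toMatrix₂_eq_gramMatrix, ← LinearMap.toMatrix₂_compl₁₂]
    ext i j
    simp [gramMatrix_apply]
  rw [hcongr, Matrix.det_mul, Matrix.det_mul, Matrix.det_transpose, LinearMap.det_toMatrix]
  ring

theorem det_gramMatrix_complexify [Module ℂ E] (b : ι → E)
    (hI : ∀ u v, B (Complex.I • u) (Complex.I • v) = B u v)
    (hb : ∀ i j, B (Complex.I • b i) (b j) = 0) :
    (gramMatrix B fun k : Fin 2 × ι => Complex.basisOneI k.1 • b k.2).det =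
      (gramMatrix B b).det ^ 2 := by
  have hb' (i j : ι) : B (b i) (Complex.I • b j) = 0 := by
    rw [← hI, smul_smul, Complex.I_mul_I]
    simp [hb]
  have hkron : (gramMatrix B fun k : Fin 2 × ι => Complex.basisOneI k.1 • b k.2) =
      (1 : Matrix (Fin 2) (Fin 2) ℝ) ⊗ₖ gramMatrix B b := by
    ext ⟨k, i⟩ ⟨l, j⟩
    fin_cases k <;> fin_cases l <;> simp [gramMatrix_apply, hI, hb, hb']
  rw [hkron, Matrix.det_kronecker]
  simp

end Gram

/-! ### Riemannian metrics in a chart -/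

section Riemannian

variable {E : Type*} [NormedAddCommGroup E] [NormedSpace ℝ E]

/-- `g` is a Riemannian metric of class `C²` on the open set `U`; this is the regularity that the
curvature tensor requires. -/
structure IsRiemannianOn (g : E → E →L[ℝ] E →L[ℝ] ℝ) (U : Set E) : Prop where
  isOpen : IsOpen U
  contDiffOn : ContDiffOn ℝ 2 g U
  symm : ∀ p ∈ U, ∀ u v, g p u v = g p v u
  pos : ∀ p ∈ U, ∀ v, v ≠ 0 → 0 < g p v v

/-- The logarithm `1/2 log det g(bᵢ, bⱼ)` of the Riemannian volume density of `g` in the linear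
coordinates of the basis `b`. -/
noncomputable def logDensity {ι : Type*} [Fintype ι] [DecidableEq ι] (b : Module.Basis ι ℝ E)
    (g : E → E →L[ℝ] E →L[ℝ] ℝ) (p : E) : ℝ :=
  1 / 2 * Real.log (gramMatrix (g p) b).det

namespace IsRiemannianOn

variable {g : E → E →L[ℝ] E →L[ℝ] ℝ} {U : Set E} {p : E}

theorem contDiffAt (hg : IsRiemannianOn g U) (hp : p ∈ U) : ContDiffAt ℝ 2 g p :=
  hg.contDiffOn.contDiffAt (hg.isOpen.mem_nhds hp)

theorem differentiableAt (hg : IsRiemannianOn g U) (hp : p ∈ U) : DifferentiableAt ℝ g p :=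
  (hg.contDiffAt hp).differentiableAt two_ne_zero

theorem contDiffAt_fderiv (hg : IsRiemannianOn g U) (hp : p ∈ U) :
    ContDiffAt ℝ 1 (fderiv ℝ g) p :=
  (hg.contDiffAt hp).fderiv_right (by norm_num)

theorem ext_of_metric (hg : IsRiemannianOn g U) (hp : p ∈ U) {u v : E}
    (h : ∀ w, g p u w = g p v w) : u = v := by
  by_contra hne
  simpa [h] using hg.pos p hp (u - v) (sub_ne_zero.mpr hne)

theorem fderiv_symm (hg : IsRiemannianOn g U) (hp : p ∈ U) (u v w : E) :
    fderiv ℝ g p u v w = fderiv ℝ g p u w v := by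
  have hsymm : (fun q => g q v w) =ᶠ[𝓝 p] fun q => g q w v := by
    filter_upwards [hg.isOpen.mem_nhds hp] with q hq using hg.symm q hq v w
  rw [← fderiv_clm_apply_apply (hg.differentiableAt hp), hsymm.fderiv_eq,
    fderiv_clm_apply_apply (hg.differentiableAt hp)]

theorem christoffel_symm (hg : IsRiemannianOn g U) (hp : p ∈ U) (u v : E) :
    christoffel g p u v = christoffel g p v u := by
  have hkoszul : koszul g p u v = koszul g p v u := by
    ext w
    rw [koszul_apply, koszul_apply, hg.fderiv_symm hp w u v]
    ring
  rw [christoffel_apply, christoffel_apply, hkoszul]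

theorem contDiffAt_koszul (hg : IsRiemannianOn g U) (hp : p ∈ U) :
    ContDiffAt ℝ 1 (koszul g) p := by
  have hflip : ContDiffAt ℝ 1 (fun q => (fderiv ℝ g q).flip) p :=
    (ContinuousLinearMap.flipₗᵢ ℝ E E (E →L[ℝ] ℝ)).contDiff.contDiffAt.comp p
      (hg.contDiffAt_fderiv hp)
  exact (((hg.contDiffAt_fderiv hp).add hflip).sub (contDiffAt_const.clm_comp hflip)).const_smul
    (1 / 2 : ℝ)

variable {ι : Type*}

theorem posDef_gramMatrix_basis [Finite ι] (hg : IsRiemannianOn g U) (hp : p ∈ U)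
    (b : Module.Basis ι ℝ E) : (gramMatrix (g p) b).PosDef :=
  posDef_gramMatrix (hg.symm p hp) (hg.pos p hp) b.linearIndependent

variable [Fintype ι] [DecidableEq ι]

theorem contDiffAt_det_gramMatrix (hg : IsRiemannianOn g U) (hp : p ∈ U)
    (b : Module.Basis ι ℝ E) : ContDiffAt ℝ 2 (fun q => (gramMatrix (g q) b).det) p :=
  contDiffAt_det fun _ _ => ((hg.contDiffAt hp).clm_apply contDiffAt_const).clm_apply
    contDiffAt_const

theorem contDiffAt_logDensity (hg : IsRiemannianOn g U) (hp : p ∈ U) (b : Module.Basis ι ℝ E) :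
    ContDiffAt ℝ 2 (logDensity b g) p :=
  contDiffAt_const.mul ((hg.contDiffAt_det_gramMatrix hp b).log
    (hg.posDef_gramMatrix_basis hp b).det_pos.ne')

variable [FiniteDimensional ℝ E]

theorem isInvertible (hg : IsRiemannianOn g U) (hp : p ∈ U) : (g p).IsInvertible := by
  have hinj : Function.Injective (g p : E →ₗ[ℝ] E →L[ℝ] ℝ) := fun u v h =>
    hg.ext_of_metric hp fun w => DFunLike.congr_fun h w
  have hfinrank : Module.finrank ℝ E = Module.finrank ℝ (E →L[ℝ] ℝ) := by
    rw [← (LinearMap.toContinuousLinearMap : (E →ₗ[ℝ] ℝ) ≃ₗ[ℝ] (E →L[ℝ] ℝ)).finrank_eq]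
    exact (Subspace.dual_finrank_eq (K := ℝ) (V := E)).symm
  exact ⟨(LinearEquiv.ofInjectiveOfFinrankEq _ hinj hfinrank).toContinuousLinearEquiv, by
    ext; rfl⟩

theorem metric_christoffel (hg : IsRiemannianOn g U) (hp : p ∈ U) (u v w : E) :
    g p (christoffel g p u v) w = koszul g p u v w := by
  rw [christoffel_apply, (hg.isInvertible hp).self_apply_inverse]

theorem fderiv_eq_christoffel (hg : IsRiemannianOn g U) (hp : p ∈ U) (u v w : E) :
    fderiv ℝ g p u v w = g p (christoffel g p u v) w + g p v (christoffel g p u w) := by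
  rw [hg.symm p hp v, hg.metric_christoffel hp, hg.metric_christoffel hp, koszul_apply,
    koszul_apply, hg.fderiv_symm hp u w v, hg.fderiv_symm hp v u w, hg.fderiv_symm hp w u v]
  ring

theorem differentiableAt_christoffel (hg : IsRiemannianOn g U) (hp : p ∈ U) :
    DifferentiableAt ℝ (christoffel g) p := by
  have : CompleteSpace E := FiniteDimensional.complete ℝ E
  have hinverse : ContDiffAt ℝ 1 (fun q => ContinuousLinearMap.inverse (g q)) p :=
    (hg.isInvertible hp).contDiffAt_map_inverse.comp p ((hg.contDiffAt hp).of_le one_le_two)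
  have hraise : ContDiffAt ℝ 1 (fun q =>
      ContinuousLinearMap.compL ℝ E (E →L[ℝ] ℝ) E (ContinuousLinearMap.inverse (g q))) p :=
    (ContinuousLinearMap.compL ℝ E (E →L[ℝ] ℝ) E).contDiff.contDiffAt.comp p hinverse
  exact (hraise.clm_comp (hg.contDiffAt_koszul hp)).differentiableAt one_ne_zero

theorem fderiv_christoffel_symm (hg : IsRiemannianOn g U) (hp : p ∈ U) (u v w : E) :
    fderiv ℝ (christoffel g) p u v w = fderiv ℝ (christoffel g) p u w v := by
  have hsymm : (fun q => christoffel g q v w) =ᶠ[𝓝 p] fun q => christoffel g q w v := by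
    filter_upwards [hg.isOpen.mem_nhds hp] with q hq using hg.christoffel_symm hq v w
  rw [← fderiv_clm_apply_apply (hg.differentiableAt_christoffel hp), hsymm.fderiv_eq,
    fderiv_clm_apply_apply (hg.differentiableAt_christoffel hp)]

theorem fderiv_fderiv_eq_christoffel (hg : IsRiemannianOn g U) (hp : p ∈ U) (u v w x : E) :
    fderiv ℝ (fderiv ℝ g) p v u w x =
      g p (fderiv ℝ (christoffel g) p v u w) x + g p w (fderiv ℝ (christoffel g) p v u x)
      + g p (christoffel g p v (christoffel g p u w)) x
      + g p (christoffel g p u w) (christoffel g p v x)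
      + g p (christoffel g p v w) (christoffel g p u x)
      + g p w (christoffel g p v (christoffel g p u x)) := by
  have hg' := (hg.differentiableAt hp).hasFDerivAt
  have hΓ (a b : E) := ((hg.differentiableAt_christoffel hp).hasFDerivAt.clm_apply
    (hasFDerivAt_const a p)).clm_apply (hasFDerivAt_const b p)
  have hleft := ((((hg.contDiffAt_fderiv hp).differentiableAt one_ne_zero).hasFDerivAt.clm_apply
    (hasFDerivAt_const u p)).clm_apply (hasFDerivAt_const w p)).clm_apply (hasFDerivAt_const x p)
  have hright := ((hg'.clm_apply (hΓ u w)).clm_apply (hasFDerivAt_const x p)).add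
    ((hg'.clm_apply (hasFDerivAt_const w p)).clm_apply (hΓ u x))
  have hcompatible : (fun q => fderiv ℝ g q u w x) =ᶠ[𝓝 p]
      fun q => g q (christoffel g q u w) x + g q w (christoffel g q u x) := by
    filter_upwards [hg.isOpen.mem_nhds hp] with q hq using hg.fderiv_eq_christoffel hq u w x
  have happly := DFunLike.congr_fun
    (hleft.unique (hright.congr_of_eventuallyEq hcompatible)) v
  simp only [ContinuousLinearMap.comp_zero, zero_add, ContinuousLinearMap.flip_apply,
    ContinuousLinearMap.flip_add, add_apply, ContinuousLinearMap.comp_apply] at happly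
  rw [happly, hg.fderiv_eq_christoffel hp, hg.fderiv_eq_christoffel hp]
  ring

theorem metric_curvature_antisymm (hg : IsRiemannianOn g U) (hp : p ∈ U) (u v w x : E) :
    g p (curvature g p v w u) x = -g p w (curvature g p v x u) := by
  have hsymm : fderiv ℝ (fderiv ℝ g) p v u w x = fderiv ℝ (fderiv ℝ g) p u v w x := by
    rw [((hg.contDiffAt hp).isSymmSndFDerivAt
      (by rw [minSmoothness_of_isRCLikeNormedField])).eq v u]
  rw [hg.fderiv_fderiv_eq_christoffel hp, hg.fderiv_fderiv_eq_christoffel hp] at hsymm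
  simp only [curvature_apply, map_add, map_sub, add_apply, sub_apply]
  linarith

theorem fderiv_det_gramMatrix (hg : IsRiemannianOn g U) (hp : p ∈ U) (b : Module.Basis ι ℝ E)
    (v : E) : fderiv ℝ (fun q => (gramMatrix (g q) b).det) p v =
      2 * (gramMatrix (g p) b).det * traceCLM E (christoffel g p v) := by
  set G := gramMatrix (g p) b
  set M := LinearMap.toMatrix b b (christoffel g p v : E →ₗ[ℝ] E)
  have hentry (i j : ι) : DifferentiableAt ℝ (fun q => gramMatrix (g q) b i j) p :=
    ((hg.differentiableAt hp).clm_apply (differentiableAt_const _)).clm_apply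
      (differentiableAt_const _)
  have hderiv : (Matrix.of fun i j => fderiv ℝ (fun q => gramMatrix (g q) b i j) p v) =
      M.transpose * G + G * M := by
    rw [toMatrix_transpose_mul_gramMatrix, gramMatrix_mul_toMatrix]
    ext i j
    exact (fderiv_clm_apply_apply (hg.differentiableAt hp) _ _ _).trans
      (hg.fderiv_eq_christoffel hp v (b i) (b j))
  rw [fderiv_det hentry, hderiv, Matrix.mul_add, Matrix.trace_add, ← Matrix.mul_assoc,
    ← Matrix.mul_assoc, Matrix.trace_mul_comm, ← Matrix.mul_assoc, Matrix.mul_adjugate,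
    Matrix.adjugate_mul, Matrix.smul_mul, Matrix.smul_mul, Matrix.one_mul, Matrix.one_mul,
    Matrix.trace_smul, Matrix.trace_smul, Matrix.trace_transpose, traceCLM_apply,
    LinearMap.trace_eq_matrix_trace ℝ b, smul_eq_mul]
  ring

theorem fderiv_logDensity (hg : IsRiemannianOn g U) (hp : p ∈ U) (b : Module.Basis ι ℝ E)
    (v : E) : fderiv ℝ (logDensity b g) p v = traceCLM E (christoffel g p v) := by
  have hdet := (hg.contDiffAt_det_gramMatrix hp b).differentiableAt two_ne_zero
  have hpos : (gramMatrix (g p) b).det ≠ 0 := (hg.posDef_gramMatrix_basis hp b).det_pos.ne'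
  unfold logDensity
  rw [fderiv_const_mul (hdet.log hpos), fderiv.log hdet hpos]
  simp only [smul_apply, smul_eq_mul, hg.fderiv_det_gramMatrix hp]
  field_simp

theorem fderiv_fderiv_logDensity (hg : IsRiemannianOn g U) (hp : p ∈ U)
    (b : Module.Basis ι ℝ E) (v w : E) :
    fderiv ℝ (fderiv ℝ (logDensity b g)) p v w =
      traceCLM E (fderiv ℝ (christoffel g) p v w) := by
  have hfirst : fderiv ℝ (logDensity b g) =ᶠ[𝓝 p] fun q => (traceCLM E).comp (christoffel g q) := by
    filter_upwards [hg.isOpen.mem_nhds hp] with q hq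
    ext v
    exact hg.fderiv_logDensity hq b v
  rw [hfirst.fderiv_eq, ((hasFDerivAt_const (traceCLM E) p).clm_comp
    (hg.differentiableAt_christoffel hp).hasFDerivAt).fderiv]
  simp

end IsRiemannianOn

end Riemannian

/-! ### Kähler metrics in a chart -/

section Kahler

variable {E F : Type*} [NormedAddCommGroup E] [NormedSpace ℝ E] [NormedAddCommGroup F]
  [NormedSpace ℝ F]

/-- `g` is a Kähler metric on the open set `U` for the constant complex structure `J`. The field
`closed` says that the form `ω(u, v) = g(J u, v)` is closed. -/
structure IsKahlerOn (g : E → E →L[ℝ] E →L[ℝ] ℝ) (J : E →L[ℝ] E) (U : Set E) : Prop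
    extends IsRiemannianOn g U where
  sq : ∀ u, J (J u) = -u
  orthogonal : ∀ p ∈ U, ∀ u v, g p (J u) (J v) = g p u v
  closed : ∀ p ∈ U, ∀ u v w,
    fderiv ℝ g p u (J v) w + fderiv ℝ g p v (J w) u + fderiv ℝ g p w (J u) v = 0

/-- The Levi form `D²φ(v, w) + D²φ(J v, J w)` of a function with respect to the constant complex
structure `J`, up to a constant the symmetric form associated with `i ∂∂̄ φ`. -/
noncomputable def leviForm (J : E →L[ℝ] E) (φ : E → F) (p v w : E) : F :=
  fderiv ℝ (fderiv ℝ φ) p v w + fderiv ℝ (fderiv ℝ φ) p (J v) (J w)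

theorem leviForm_comp {G : Type*} [NormedAddCommGroup G] [NormedSpace ℝ G] {f : F → G}
    {L : E → F} {p : E} (hf : ContDiffAt ℝ 2 f (L p)) (hL : ContDiffAt ℝ 2 L p) (J : E →L[ℝ] E)
    (v w : E) :
    leviForm J (f ∘ L) p v w =
      fderiv ℝ (fderiv ℝ f) (L p) (fderiv ℝ L p v) (fderiv ℝ L p w)
        + fderiv ℝ (fderiv ℝ f) (L p) (fderiv ℝ L p (J v)) (fderiv ℝ L p (J w))
        + fderiv ℝ f (L p) (leviForm J L p v w) := by
  rw [leviForm, leviForm, fderiv_fderiv_comp hf hL, fderiv_fderiv_comp hf hL, map_add]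
  abel

namespace IsKahlerOn

variable {g : E → E →L[ℝ] E →L[ℝ] ℝ} {J : E →L[ℝ] E} {U : Set E} {p : E}

theorem fderiv_orthogonal (hg : IsKahlerOn g J U) (hp : p ∈ U) (u v w : E) :
    fderiv ℝ g p u (J v) (J w) = fderiv ℝ g p u v w := by
  have horth : (fun q => g q (J v) (J w)) =ᶠ[𝓝 p] fun q => g q v w := by
    filter_upwards [hg.isOpen.mem_nhds hp] with q hq using hg.orthogonal q hq v w
  rw [← fderiv_clm_apply_apply (hg.differentiableAt hp), horth.fderiv_eq,
    fderiv_clm_apply_apply (hg.differentiableAt hp)]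

theorem metric_J_left (hg : IsKahlerOn g J U) (hp : p ∈ U) (u v : E) :
    g p (J u) v = -g p u (J v) := by
  rw [← hg.orthogonal p hp (J u), hg.sq, map_neg, neg_apply]

theorem fderiv_J_left (hg : IsKahlerOn g J U) (hp : p ∈ U) (u v w : E) :
    fderiv ℝ g p u (J v) w = -fderiv ℝ g p u v (J w) := by
  rw [← hg.fderiv_orthogonal hp u (J v), hg.sq, map_neg, neg_apply]

variable [FiniteDimensional ℝ E]

/-- The complex structure of a Kähler metric is parallel. -/
theorem christoffel_J_right (hg : IsKahlerOn g J U) (hp : p ∈ U) (u v : E) :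
    christoffel g p u (J v) = J (christoffel g p u v) := by
  refine hg.ext_of_metric hp fun w => ?_
  rw [hg.metric_J_left hp, hg.metric_christoffel hp, hg.metric_christoffel hp, koszul_apply,
    koszul_apply]
  have hclosed := hg.closed p hp v w u
  have hclosedJ := hg.closed p hp (J v) (J w) u
  simp only [hg.sq, hg.fderiv_J_left hp, map_neg, neg_apply, neg_neg] at hclosed hclosedJ ⊢
  rw [hg.fderiv_symm hp v w, hg.fderiv_J_left hp v u] at hclosed
  rw [hg.fderiv_symm hp (J v) w] at hclosedJ
  linarith [hg.fderiv_J_left hp v u w, hg.fderiv_symm hp v w (J u)]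

theorem christoffel_J_left (hg : IsKahlerOn g J U) (hp : p ∈ U) (u v : E) :
    christoffel g p (J u) v = J (christoffel g p u v) := by
  rw [hg.christoffel_symm hp, hg.christoffel_J_right hp, hg.christoffel_symm hp]

theorem fderiv_christoffel_J_right (hg : IsKahlerOn g J U) (hp : p ∈ U) (u v w : E) :
    fderiv ℝ (christoffel g) p u v (J w) = J (fderiv ℝ (christoffel g) p u v w) := by
  have hΓ := hg.differentiableAt_christoffel hp
  have hJ : (fun q => christoffel g q v (J w)) =ᶠ[𝓝 p] fun q => J (christoffel g q v w) := by
    filter_upwards [hg.isOpen.mem_nhds hp] with q hq using hg.christoffel_J_right hq v w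
  have hd : DifferentiableAt ℝ (fun q => christoffel g q v w) p := by fun_prop
  rw [← fderiv_clm_apply_apply hΓ, hJ.fderiv_eq, ← fderiv_clm_apply_apply hΓ]
  exact DFunLike.congr_fun (J.hasFDerivAt.comp p hd.hasFDerivAt).fderiv u

theorem fderiv_christoffel_J_left (hg : IsKahlerOn g J U) (hp : p ∈ U) (u v w : E) :
    fderiv ℝ (christoffel g) p u (J v) w = J (fderiv ℝ (christoffel g) p u v w) := by
  rw [hg.fderiv_christoffel_symm hp, hg.fderiv_christoffel_J_right hp,
    hg.fderiv_christoffel_symm hp]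

theorem curvature_J_right (hg : IsKahlerOn g J U) (hp : p ∈ U) (u v w : E) :
    curvature g p v (J w) u = J (curvature g p v w u) := by
  simp only [curvature_apply, hg.fderiv_christoffel_J_right hp, hg.christoffel_J_right hp,
    map_add, map_sub]

/-- The difference `P(u, v) = R(u, v) - R(J u, J v)` is skew-adjoint, commutes with `J` and
satisfies `P(J u, v) = J P(u, v)`. So `J P(u, v)` is both skew-adjoint and, being the product of
commuting skew-adjoint maps, self-adjoint. -/
theorem curvature_J_J (hg : IsKahlerOn g J U) (hp : p ∈ U) (u v w : E) :
    curvature g p (J v) w (J u) = curvature g p v w u := by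
  let P (u w : E) : E := curvature g p v w u - curvature g p (J v) w (J u)
  have hskew (u w x : E) : g p (P u w) x = -g p w (P u x) := by
    simp only [P, map_sub, sub_apply, hg.metric_curvature_antisymm hp]
    ring
  have hPJ (w : E) : P u (J w) = J (P u w) := by
    simp only [P, hg.curvature_J_right hp, map_sub]
  have hJP (w : E) : P (J u) w = J (P u w) := by
    simp only [P, curvature_apply, hg.fderiv_christoffel_J_left hp, hg.christoffel_J_left hp,
      hg.christoffel_J_right hp, hg.sq, map_add, map_sub, map_neg, neg_apply]
    abel
  have hJP_zero : J (P u w) = 0 := by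
    refine hg.ext_of_metric hp fun x => ?_
    have hskewJ : g p (J (P u w)) x = -g p w (J (P u x)) := by rw [← hJP, ← hJP, hskew]
    have hself : g p (J (P u w)) x = g p w (J (P u x)) := by
      rw [← hPJ, hskew, hg.metric_J_left hp, neg_neg]
    rw [map_zero, zero_apply]
    linarith
  have hP_zero : P u w = 0 := by rw [← neg_eq_zero, ← hg.sq, hJP_zero, map_zero]
  exact (sub_eq_zero.1 hP_zero).symm

theorem two_smul_curvature (hg : IsKahlerOn g J U) (hp : p ∈ U) (u v w : E) :
    (2 : ℝ) • curvature g p v w u =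
      fderiv ℝ (christoffel g) p u v w + J (fderiv ℝ (christoffel g) p (J u) v w)
        - (fderiv ℝ (christoffel g) p v w u + fderiv ℝ (christoffel g) p (J v) (J w) u) := by
  rw [two_smul]
  nth_rewrite 2 [← hg.curvature_J_J hp]
  rw [hg.fderiv_christoffel_symm hp v w, hg.fderiv_christoffel_symm hp (J v) (J w)]
  simp only [curvature_apply, hg.fderiv_christoffel_J_left hp, hg.fderiv_christoffel_J_right hp,
    hg.christoffel_J_left hp, hg.christoffel_J_right hp, hg.sq]
  abel

/-- In `two_smul_curvature` the terms differentiated in the direction of the traced variable `u`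
anticommute with `J`, so only the second bracket contributes to the trace. -/
theorem ricci_eq_leviForm (hg : IsKahlerOn g J U) (hp : p ∈ U) {ι : Type*} [Fintype ι]
    [DecidableEq ι] (b : Module.Basis ι ℝ E) (v w : E) :
    ricci g p v w = -(1 / 2) * leviForm J (logDensity b g) p v w := by
  let A : E →L[ℝ] E := ((fderiv ℝ (christoffel g) p).flip v).flip w
  have hA (u : E) : (A + J.comp (A.comp J)) (J u) = -J ((A + J.comp (A.comp J)) u) := by
    simp [hg.sq]
  have hcurvature : (2 : ℝ) • curvature g p v w = A + J.comp (A.comp J)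
      - (fderiv ℝ (christoffel g) p v w + fderiv ℝ (christoffel g) p (J v) (J w)) := by
    ext u
    exact hg.two_smul_curvature hp u v w
  have htrace := congrArg (traceCLM E) hcurvature
  rw [map_sub, map_add _ (fderiv ℝ (christoffel g) p v w),
    traceCLM_eq_zero_of_anticommute hg.sq hA, map_smul, smul_eq_mul,
    ← hg.fderiv_fderiv_logDensity hp b, ← hg.fderiv_fderiv_logDensity hp b] at htrace
  rw [leviForm, ricci, ← traceCLM_apply]
  linarith

end IsKahlerOn

end Kahler

/-! ### Kähler forms on the complex torus -/

section Torus

variable {n : ℕ}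

/-- Multiplication by `i` on `ℂⁿ`: the complex structure as a real linear map. -/
noncomputable def mulI (n : ℕ) : (Fin n → ℂ) →L[ℝ] (Fin n → ℂ) :=
  Complex.I • ContinuousLinearMap.id ℝ (Fin n → ℂ)

theorem mulI_apply (u : Fin n → ℂ) : mulI n u = Complex.I • u := rfl

theorem isOpen_cstar (n : ℕ) : IsOpen (cstar n) := by
  simp only [cstar, Set.ofPred_forall]
  exact isOpen_iInter_of_finite fun j => isOpen_ne.preimage (continuous_apply j)

theorem form_antisymm {E : Type*} [NormedAddCommGroup E] [NormedSpace ℝ E]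
    (ω : E [⋀^Fin 2]→L[ℝ] ℝ) (u v : E) : ω ![u, v] = -ω ![v, u] := by
  have hswap : ![u, v] = ![v, u] ∘ Equiv.swap 0 1 := by
    ext i
    fin_cases i <;> rfl
  rw [hswap]
  exact ω.toAlternatingMap.map_swap ![v, u] Fin.zero_ne_one

variable {ω : (Fin n → ℂ) → (Fin n → ℂ) [⋀^Fin 2]→L[ℝ] ℝ} {z : Fin n → ℂ}

namespace IsKahlerForm

theorem differentiableAt (hω : IsKahlerForm ω) (hz : z ∈ cstar n) : DifferentiableAt ℝ ω z :=
  (hω.smooth.contDiffAt ((isOpen_cstar n).mem_nhds hz)).differentiableAt (by simp)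

theorem contDiffOn_kahlerMetric (hω : IsKahlerForm ω) :
    ContDiffOn ℝ 2 (kahlerMetric ω) (cstar n) := by
  refine contDiffOn_clm_apply.2 fun u => contDiffOn_clm_apply.2 fun v => ?_
  simp only [kahlerMetric_apply]
  exact ((ContinuousMultilinearMap.apply ℝ (fun _ : Fin 2 => Fin n → ℂ) ℝ ![u, Complex.I • v]).comp
    (ContinuousAlternatingMap.toContinuousMultilinearMapCLM ℝ)).contDiff.comp_contDiffOn
      (hω.smooth.of_le (WithTop.coe_le_coe.2 le_top))

theorem fderiv_kahlerMetric_mulI (hω : IsKahlerForm ω) (hz : z ∈ cstar n) (u v w : Fin n → ℂ) :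
    fderiv ℝ (kahlerMetric ω) z u (mulI n v) w = fderiv ℝ (fun y => ω y ![v, w]) z u := by
  have hnhds := (isOpen_cstar n).mem_nhds hz
  have hform : (fun y => kahlerMetric ω y (mulI n v) w) =ᶠ[𝓝 z] fun y => ω y ![v, w] := by
    filter_upwards [hnhds] with y hy
    rw [kahlerMetric_apply, mulI_apply, hω.compatible y hy]
  rw [← hform.fderiv_eq, fderiv_clm_apply_apply
    ((hω.contDiffOn_kahlerMetric.contDiffAt hnhds).differentiableAt two_ne_zero)]

theorem fderiv_cyclic (hω : IsKahlerForm ω) (hz : z ∈ cstar n) (u v w : Fin n → ℂ) :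
    fderiv ℝ (fun y => ω y ![v, w]) z u + fderiv ℝ (fun y => ω y ![w, u]) z v
      + fderiv ℝ (fun y => ω y ![u, v]) z w = 0 := by
  have hclosed := congrArg (fun η => η ![u, v, w]) (hω.closed z hz)
  have hremove0 : (0 : Fin 3).removeNth ![u, v, w] = ![v, w] := by
    ext i; fin_cases i <;> rfl
  have hremove1 : (1 : Fin 3).removeNth ![u, v, w] = ![u, w] := by
    ext i; fin_cases i <;> rfl
  have hremove2 : (2 : Fin 3).removeNth ![u, v, w] = ![u, v] := by
    ext i; fin_cases i <;> rfl
  have hswap : fderiv ℝ (fun y => ω y ![u, w]) z = -fderiv ℝ (fun y => ω y ![w, u]) z := by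
    simp only [form_antisymm _ u w, fderiv_fun_neg]
  simp only [Nat.reduceAdd, extDeriv_apply (hω.differentiableAt hz), Int.reduceNeg, zsmul_eq_mul,
    Int.cast_pow, Int.cast_neg, Int.cast_one, Fin.sum_univ_three, Fin.isValue,
    Fin.coe_ofNat_eq_mod, Nat.zero_mod, pow_zero, hremove0, Nat.succ_eq_add_one,
    Matrix.cons_val_zero, one_mul, Nat.one_mod, pow_one, hremove1, hswap, Matrix.cons_val_one,
    neg_apply, mul_neg, neg_mul, neg_neg, Nat.mod_succ, even_two, Even.neg_pow, one_pow, hremove2,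
    Matrix.cons_val, ContinuousAlternatingMap.coe_zero, Pi.zero_apply] at hclosed
  linarith

theorem isKahlerOn (hω : IsKahlerForm ω) : IsKahlerOn (kahlerMetric ω) (mulI n) (cstar n) where
  isOpen := isOpen_cstar n
  contDiffOn := hω.contDiffOn_kahlerMetric
  symm z hz u v := by
    rw [kahlerMetric_apply, kahlerMetric_apply, form_antisymm, ← hω.compatible z hz v,
      smul_smul, Complex.I_mul_I, neg_one_smul, ← formToBilin_apply, ← formToBilin_apply, map_neg]
  pos z hz v hv := by
    rw [kahlerMetric_apply]
    exact hω.positive z hz v hv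
  sq u := by rw [mulI_apply, mulI_apply, smul_smul, Complex.I_mul_I, neg_one_smul]
  orthogonal z hz u v := by
    rw [kahlerMetric_apply, kahlerMetric_apply, mulI_apply, mulI_apply, hω.compatible z hz]
  closed z hz u v w := by
    simp only [hω.fderiv_kahlerMetric_mulI hz]
    exact hω.fderiv_cyclic hz u v w

end IsKahlerForm

/-! ### The fundamental vector fields and the volume of the orbits -/

/-- The frame of fundamental vector fields of the standard basis of the Lie algebra, at `z`. -/
noncomputable def fundFrame (z : Fin n → ℂ) (i : Fin n) : Fin n → ℂ := fundField (Pi.single i 1) z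

/-- The Gram matrix of the fundamental vector fields: the metric induced on the orbit of `z` in
angular coordinates. -/
noncomputable def orbitGram (ω : (Fin n → ℂ) → (Fin n → ℂ) [⋀^Fin 2]→L[ℝ] ℝ) (z : Fin n → ℂ) :
    Matrix (Fin n) (Fin n) ℝ :=
  gramMatrix (kahlerMetric ω z) (fundFrame z)

theorem fundFrame_eq_single (z : Fin n → ℂ) (i : Fin n) :
    fundFrame z i = Pi.single i (Complex.I * z i) := by
  ext j
  by_cases h : j = i
  · subst h; simp [fundFrame, fundField]
  · simp [fundFrame, fundField, h]

theorem linearIndependent_fundFrame (hz : z ∈ cstar n) : LinearIndependent ℝ (fundFrame z) := by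
  simpa only [← fundFrame_eq_single] using
    Pi.linearIndependent_single_of_ne_zero (R := ℝ) fun i => mul_ne_zero Complex.I_ne_zero (hz i)

theorem torusAct_mem (hz : z ∈ cstar n) (t : Fin n → Circle) : torusAct t z ∈ cstar n :=
  fun j => mul_ne_zero (Circle.coe_ne_zero _) (hz j)

theorem fundField_torusAct (X : Fin n → ℝ) (t : Fin n → Circle) (z : Fin n → ℂ) :
    fundField X (torusAct t z) = torusAct t (fundField X z) := by
  ext j
  simp only [fundField, torusAct]
  ring

theorem smul_torusAct (c : ℂ) (t : Fin n → Circle) (z : Fin n → ℂ) :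
    c • torusAct t z = torusAct t (c • z) := by
  ext j
  simp only [torusAct, Pi.smul_apply, smul_eq_mul]
  ring

theorem IsKahlerForm.det_orbitGram_pos (hω : IsKahlerForm ω) (hz : z ∈ cstar n) :
    0 < (orbitGram ω z).det :=
  (posDef_gramMatrix (hω.isKahlerOn.symm z hz) (hω.isKahlerOn.pos z hz)
    (linearIndependent_fundFrame hz)).det_pos

namespace IsHamiltonian

/-- The moment map is constant along the orbits, so these are isotropic. -/
theorem form_fundField (h : IsHamiltonian ω) (hz : z ∈ cstar n) (X Y : Fin n → ℝ) :
    ω z ![fundField X z, fundField Y z] = 0 := by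
  obtain ⟨μ, hμ⟩ := h
  have hstart : torusAct (torusExp ((0 : ℝ) • Y)) z = z := by
    ext j
    simp [torusAct, torusExp]
  have hd : HasFDerivAt (fun y => μ y X) (fderiv ℝ (fun y => μ y X) z)
      (torusAct (torusExp ((0 : ℝ) • Y)) z) := by
    rw [hstart]
    exact ((hμ.differentiableAt z hz).clm_apply (differentiableAt_const X)).hasFDerivAt
  have hderiv := hd.comp_hasDerivAt (0 : ℝ) (hasDerivAt_fundField Y z)
  have hconst : (fun y => μ y X) ∘ (fun s : ℝ => torusAct (torusExp (s • Y)) z) =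
      fun _ => μ z X :=
    funext fun s => by rw [Function.comp_apply, hμ.equivariant _ z hz]
  rw [hconst] at hderiv
  rw [← hμ.fderiv_eq X z hz]
  exact hderiv.unique (hasDerivAt_const _ _)

theorem form_torusAct (h : IsHamiltonian ω) (hz : z ∈ cstar n) (t : Fin n → Circle)
    (X : Fin n → ℝ) (v : Fin n → ℂ) :
    ω (torusAct t z) ![fundField X (torusAct t z), torusAct t v] = ω z ![fundField X z, v] := by
  obtain ⟨μ, hμ⟩ := h
  let T : (Fin n → ℂ) →L[ℝ] (Fin n → ℂ) := ContinuousLinearMap.mul ℝ (Fin n → ℂ) fun j => t j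
  have hd : DifferentiableAt ℝ (fun y => μ y X) (T z) :=
    (hμ.differentiableAt _ (torusAct_mem hz t)).clm_apply (differentiableAt_const X)
  have hinv : (fun y => μ y X) =ᶠ[𝓝 z] (fun y => μ y X) ∘ T := by
    filter_upwards [(isOpen_cstar n).mem_nhds hz] with y hy
    exact congrArg (· X) (hμ.equivariant t y hy).symm
  rw [← hμ.fderiv_eq X _ (torusAct_mem hz t), ← hμ.fderiv_eq X z hz, hinv.fderiv_eq,
    (hd.hasFDerivAt.comp z T.hasFDerivAt).fderiv]
  rfl

theorem orbitGram_torusAct (h : IsHamiltonian ω) (hz : z ∈ cstar n) (t : Fin n → Circle) :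
    orbitGram ω (torusAct t z) = orbitGram ω z := by
  ext i j
  simp only [orbitGram, gramMatrix_apply, kahlerMetric_apply, fundFrame]
  rw [fundField_torusAct (Pi.single j 1), smul_torusAct, h.form_torusAct hz]

theorem detH_eq (h : IsHamiltonian ω) (hz : z ∈ cstar n) :
    detH ω z = ((orbitGram ω z).det : ℂ) := by
  have hreal : (Matrix.of fun i j : Fin n => kahlerHermitian ω z (fundField (Pi.single i 1) z)
      (fundField (Pi.single j 1) z)) = (orbitGram ω z).map Complex.ofRealHom := by
    ext i j
    simp [kahlerHermitian, h.form_fundField hz, orbitGram, gramMatrix_apply, fundFrame]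
  rw [detH, hreal, ← RingHom.mapMatrix_apply, ← RingHom.map_det]
  rfl

theorem detH_torusAct (h : IsHamiltonian ω) (hz : z ∈ cstar n) (t : Fin n → Circle) :
    detH ω (torusAct t z) = detH ω z := by
  rw [h.detH_eq hz, h.detH_eq (torusAct_mem hz t), h.orbitGram_torusAct hz]

end IsHamiltonian

theorem fderiv_torusExp (z : Fin n → ℂ) (θ v : Fin n → ℝ) :
    fderiv ℝ (fun θ : Fin n → ℝ => torusAct (torusExp θ) z) θ v =
      fundField v (torusAct (torusExp θ) z) := by
  have hd : DifferentiableAt ℝ (fun θ : Fin n → ℝ => torusAct (torusExp θ) z)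
      (θ + (0 : ℝ) • v) := by
    unfold torusAct torusExp
    simp only [Circle.coe_exp]
    fun_prop
  have hadd (s : ℝ) : torusAct (torusExp (θ + s • v)) z =
      torusAct (torusExp (s • v)) (torusAct (torusExp θ) z) := by
    ext j
    simp only [torusAct, torusExp, Pi.add_apply, Circle.exp_add, Circle.coe_mul]
    ring
  have hline := hasDerivAt_comp_line hd
  simp only [hadd, zero_smul, add_zero] at hline
  exact hline.unique (hasDerivAt_fundField v _)

theorem IsHamiltonian.orbitVolume_eq (h : IsHamiltonian ω) (hz : z ∈ cstar n) :
    orbitVolume ω z = (2 * Real.pi) ^ n * Real.sqrt (orbitGram ω z).det := by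
  have hgram (θ : Fin n → ℝ) : (Matrix.of fun i j : Fin n =>
      kahlerMetric ω (torusAct (torusExp θ) z)
        (fderiv ℝ (fun θ : Fin n → ℝ => torusAct (torusExp θ) z) θ (Pi.single i 1))
        (fderiv ℝ (fun θ : Fin n → ℝ => torusAct (torusExp θ) z) θ (Pi.single j 1))) =
      orbitGram ω z := by
    rw [← h.orbitGram_torusAct hz (torusExp θ)]
    simp only [fderiv_torusExp]
    rfl
  have hbox : MeasureTheory.volume.real (angleBox n) = (2 * Real.pi) ^ n := by
    simp [angleBox, MeasureTheory.measureReal_def, MeasureTheory.volume_pi_pi, Real.pi_pos.le]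
  simp only [orbitVolume, paramVolume, hgram]
  rw [MeasureTheory.setIntegral_const, smul_eq_mul, hbox]

theorem IsHamiltonian.orbitVolume_torusAct (h : IsHamiltonian ω) (hz : z ∈ cstar n)
    (t : Fin n → Circle) : orbitVolume ω (torusAct t z) = orbitVolume ω z := by
  rw [h.orbitVolume_eq hz, h.orbitVolume_eq (torusAct_mem hz t), h.orbitGram_torusAct hz]

end Torus

section OrbitSpace

variable {n : ℕ} {ω : (Fin n → ℂ) → (Fin n → ℂ) [⋀^Fin 2]→L[ℝ] ℝ} {z : Fin n → ℂ}

/-! ### Logarithmic coordinates on the orbit space -/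

/-- The coordinates `(log |z₁|, …, log |zₙ|)` of the orbit of `z` in the orbit space `ℝⁿ`. -/
noncomputable def logNorm (z : Fin n → ℂ) : Fin n → ℝ := fun j => Real.log ‖z j‖

theorem expPoint_mem (x : Fin n → ℝ) : expPoint x ∈ cstar n := fun _ => Complex.exp_ne_zero _

theorem logNorm_expPoint (x : Fin n → ℝ) : logNorm (expPoint x) = x := by
  ext j
  simp [logNorm, expPoint, Complex.norm_exp]

theorem logNorm_torusAct (t : Fin n → Circle) (z : Fin n → ℂ) :
    logNorm (torusAct t z) = logNorm z := by
  ext j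
  simp only [logNorm, torusAct, norm_mul, Circle.norm_coe, one_mul]

theorem exists_torusAct_expPoint (hz : z ∈ cstar n) :
    ∃ t : Fin n → Circle, torusAct t (expPoint (logNorm z)) = z := by
  obtain ⟨x, ⟨t, ht⟩, -⟩ := existsUnique_expPoint z hz
  have hx : logNorm z = x := by rw [← ht, logNorm_torusAct, logNorm_expPoint]
  exact ⟨t, by rw [hx, ht]⟩

theorem contDiff_expPoint {k : WithTop ℕ∞} : ContDiff ℝ k (expPoint (n := n)) :=
  contDiff_pi.2 fun j => (Complex.ofRealCLM.contDiff.comp (contDiff_apply ℝ ℝ j)).cexp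

theorem contDiffAt_logNorm {k : WithTop ℕ∞} (hz : z ∈ cstar n) : ContDiffAt ℝ k logNorm z :=
  contDiffAt_pi.2 fun j =>
    ((contDiff_apply ℝ ℂ j).contDiffAt.norm ℝ (hz j)).log (norm_ne_zero_iff.2 (hz j))

theorem hasDerivAt_log_norm {w : ℝ → ℂ} {w' : ℂ} {s : ℝ} (hw : HasDerivAt w w' s)
    (h0 : w s ≠ 0) : HasDerivAt (fun t => Real.log ‖w t‖) (w' / w s).re s := by
  have hsq : (fun t => Real.log ‖w t‖) = fun t => 1 / 2 * Real.log (‖w t‖ ^ 2) := by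
    funext t
    rw [Real.log_pow]
    push_cast
    ring
  have hne : ‖w s‖ ^ 2 ≠ 0 := pow_ne_zero _ (norm_ne_zero_iff.2 h0)
  rw [hsq]
  refine ((hw.norm_sq.log hne).const_mul (1 / 2)).congr_deriv ?_
  rw [Complex.inner, Complex.div_re, ← Complex.sq_norm]
  simp only [Complex.mul_re, Complex.conj_re, Complex.conj_im]
  field_simp
  ring

theorem fderiv_logNorm (hz : z ∈ cstar n) (v : Fin n → ℂ) :
    fderiv ℝ logNorm z v = fun j => (v j / z j).re := by
  have hz0 : z + (0 : ℝ) • v = z := by rw [zero_smul, add_zero]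
  have hline := hasDerivAt_comp_line (s := 0) (v := v)
    (by rw [hz0]; exact (contDiffAt_logNorm hz).differentiableAt one_ne_zero)
  have hcoord : HasDerivAt (fun s : ℝ => logNorm (z + s • v)) _ 0 := hasDerivAt_pi.2 fun j =>
    hasDerivAt_log_norm (hasDerivAt_line (z j) (v j) 0) (by simpa using hz j)
  simpa only [zero_smul, add_zero] using hline.unique hcoord

theorem fderiv_fderiv_logNorm (hz : z ∈ cstar n) (v w : Fin n → ℂ) :
    fderiv ℝ (fderiv ℝ logNorm) z v w = fun j => (-(v j * w j) / z j ^ 2).re := by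
  have hz0 : z + (0 : ℝ) • v = z := by rw [zero_smul, add_zero]
  have hd : DifferentiableAt ℝ (fderiv ℝ logNorm) z :=
    ((contDiffAt_logNorm (k := 2) hz).fderiv_right (by norm_num)).differentiableAt one_ne_zero
  have hline : HasDerivAt (fun s : ℝ => fderiv ℝ logNorm (z + s • v) w)
      (fderiv ℝ (fderiv ℝ logNorm) z v w) 0 := by
    rw [← hz0] at hd
    simpa [hz0] using (hasDerivAt_comp_line hd).clm_apply (hasDerivAt_const (0 : ℝ) w)
  have hnear : (fun s : ℝ => fderiv ℝ logNorm (z + s • v) w) =ᶠ[𝓝 0]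
      fun s j => (w j * (z j + s • v j)⁻¹).re := by
    filter_upwards [(hasDerivAt_line z v 0).continuousAt.eventually_mem
      ((isOpen_cstar n).mem_nhds (by rwa [hz0]))] with s hs
    rw [fderiv_logNorm hs]; rfl
  have hcoord (j : Fin n) :
      HasDerivAt (fun s : ℝ => (w j * (z j + s • v j)⁻¹).re) (-(v j * w j) / z j ^ 2).re 0 := by
    have hinv := (hasDerivAt_line (z j) (v j) 0).fun_inv (by simpa using hz j)
    refine (Complex.reCLM.hasFDerivAt.comp_hasDerivAt (0 : ℝ)
      (hinv.const_mul (w j))).congr_deriv ?_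
    rw [zero_smul, add_zero, mul_div_assoc', mul_neg, mul_comm]
    rfl
  exact hline.unique ((hasDerivAt_pi.2 hcoord).congr_of_eventuallyEq hnear)

theorem leviForm_logNorm (hz : z ∈ cstar n) (v w : Fin n → ℂ) :
    leviForm (mulI n) logNorm z v w = 0 := by
  ext j
  have hI : Complex.I * v j * (Complex.I * w j) = -(v j * w j) := by
    rw [mul_mul_mul_comm, Complex.I_mul_I, neg_one_mul]
  simp only [leviForm, fderiv_fderiv_logNorm hz, mulI_apply, Pi.add_apply, Pi.smul_apply,
    smul_eq_mul, Pi.zero_apply, hI, ← Complex.add_re, neg_neg, ← add_div, neg_add_cancel,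
    zero_div, Complex.zero_re]

/-! ### The volume density in logarithmic coordinates -/

/-- The real basis `e₁, …, eₙ, i e₁, …, i eₙ` of `ℂⁿ`. -/
noncomputable def coordBasis (n : ℕ) : Module.Basis (Fin 2 × Fin n) ℝ (Fin n → ℂ) :=
  Complex.basisOneI.smulTower (Pi.basisFun ℂ (Fin n))

theorem det_mul (c : Fin n → ℂ) :
    LinearMap.det (ContinuousLinearMap.mul ℝ (Fin n → ℂ) c : (Fin n → ℂ) →ₗ[ℝ] (Fin n → ℂ)) =
      ∏ j, ‖c j‖ ^ 2 := by
  have hpi : (ContinuousLinearMap.mul ℝ (Fin n → ℂ) c : (Fin n → ℂ) →ₗ[ℝ] (Fin n → ℂ)) =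
      LinearMap.pi fun j => (LinearMap.mul ℝ ℂ (c j)).comp (LinearMap.proj j) := rfl
  rw [hpi, LinearMap.det_pi]
  refine Finset.prod_congr rfl fun j _ => ?_
  rw [← Complex.normSq_eq_norm_sq, ← Algebra.norm_complex_apply, Algebra.norm_apply]
  rfl

theorem mul_comp_coordBasis (z : Fin n → ℂ) :
    ContinuousLinearMap.mul ℝ (Fin n → ℂ) (fun j => Complex.I * z j) ∘ coordBasis n =
      fun k => Complex.basisOneI k.1 • fundFrame z k.2 := by
  funext k
  rw [Function.comp_apply, coordBasis, Module.Basis.smulTower_apply, fundFrame_eq_single]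
  ext j
  by_cases h : j = k.2
  · subst h; simp [mul_comm]
  · simp [h]

theorem IsHamiltonian.det_orbitGram_sq (hω : IsKahlerForm ω) (h : IsHamiltonian ω)
    (hz : z ∈ cstar n) :
    (orbitGram ω z).det ^ 2 =
      (∏ j, ‖z j‖ ^ 2) ^ 2 * (gramMatrix (kahlerMetric ω z) (coordBasis n)).det := by
  have horth (i j : Fin n) :
      kahlerMetric ω z (Complex.I • fundFrame z i) (fundFrame z j) = 0 := by
    rw [kahlerMetric_apply, hω.compatible z hz]
    exact h.form_fundField hz _ _
  rw [orbitGram, ← det_gramMatrix_complexify (kahlerMetric ω z) (fundFrame z)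
    (hω.isKahlerOn.orthogonal z hz) horth, ← mul_comp_coordBasis, det_gramMatrix_comp, det_mul]
  simp only [norm_mul, Complex.norm_I, one_mul]

theorem IsHamiltonian.vol_logNorm (h : IsHamiltonian ω) (hz : z ∈ cstar n) :
    vol ω (logNorm z) = orbitVolume ω z := by
  obtain ⟨t, ht⟩ := exists_torusAct_expPoint hz
  conv_rhs => rw [← ht, h.orbitVolume_torusAct (expPoint_mem _)]
  rfl

theorem log_orbitVolume (hω : IsKahlerForm ω) (h : IsHamiltonian ω) (hz : z ∈ cstar n) :
    Real.log (orbitVolume ω z) =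
      n * Real.log (2 * Real.pi) + 1 / 2 * Real.log (orbitGram ω z).det := by
  have hdet := hω.det_orbitGram_pos hz
  rw [h.orbitVolume_eq hz, Real.log_mul (pow_ne_zero _ Real.two_pi_pos.ne')
    (Real.sqrt_pos.2 hdet).ne', Real.log_pow, Real.log_sqrt hdet.le]
  ring

theorem logDensity_eq_log_vol (hω : IsKahlerForm ω) (h : IsHamiltonian ω) (hz : z ∈ cstar n) :
    logDensity (coordBasis n) (kahlerMetric ω) z =
      2 * Real.log (vol ω (logNorm z)) +
        (-2 * ∑ j, logNorm z j + -2 * (n * Real.log (2 * Real.pi))) := by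
  have hnorm (j : Fin n) : ‖z j‖ ^ 2 ≠ 0 := pow_ne_zero _ (norm_ne_zero_iff.2 (hz j))
  have hprod : Real.log (∏ j, ‖z j‖ ^ 2) = 2 * ∑ j, logNorm z j := by
    rw [Real.log_prod fun j _ => hnorm j, Finset.mul_sum]
    exact Finset.sum_congr rfl fun j _ => by
      rw [Real.log_pow]; rfl
  have hlog := congrArg Real.log (h.det_orbitGram_sq hω hz)
  rw [Real.log_mul (pow_ne_zero _ (Finset.prod_ne_zero_iff.2 fun j _ => hnorm j))
    (hω.isKahlerOn.posDef_gramMatrix_basis hz (coordBasis n)).det_pos.ne', Real.log_pow,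
    Real.log_pow, hprod] at hlog
  rw [h.vol_logNorm hz, log_orbitVolume hω h hz, logDensity]
  push_cast at hlog
  linarith

theorem vol_pos (hω : IsKahlerForm ω) (h : IsHamiltonian ω) (x : Fin n → ℝ) : 0 < vol ω x := by
  rw [vol, h.orbitVolume_eq (expPoint_mem x)]
  exact mul_pos (pow_pos Real.two_pi_pos n)
    (Real.sqrt_pos.2 (hω.det_orbitGram_pos (expPoint_mem x)))

theorem contDiff_log_vol (hω : IsKahlerForm ω) (h : IsHamiltonian ω) :
    ContDiff ℝ 2 fun x => Real.log (vol ω x) := by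
  have hlog : (fun x => Real.log (vol ω x)) = fun x =>
      1 / 2 * logDensity (coordBasis n) (kahlerMetric ω) (expPoint x) +
        (∑ j, x j + n * Real.log (2 * Real.pi)) := by
    funext x
    rw [logDensity_eq_log_vol hω h (expPoint_mem x), logNorm_expPoint]
    ring
  have hdensity : ContDiff ℝ 2 fun x =>
      logDensity (coordBasis n) (kahlerMetric ω) (expPoint x) :=
    contDiff_iff_contDiffAt.2 fun x =>
      (hω.isKahlerOn.contDiffAt_logDensity (expPoint_mem x) _).comp x contDiff_expPoint.contDiffAt
  rw [hlog]
  fun_prop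

/-! ### The Ricci tensor and the volume functional -/

theorem ricci_eq_hessian_log_vol (hω : IsKahlerForm ω) (h : IsHamiltonian ω) (hz : z ∈ cstar n)
    (v w : Fin n → ℂ) :
    ricci (kahlerMetric ω) z v w =
      -(fderiv ℝ (fderiv ℝ fun x => Real.log (vol ω x)) (logNorm z)
          (fderiv ℝ logNorm z v) (fderiv ℝ logNorm z w) +
        fderiv ℝ (fderiv ℝ fun x => Real.log (vol ω x)) (logNorm z)
          (fderiv ℝ logNorm z (mulI n v)) (fderiv ℝ logNorm z (mulI n w))) := by
  let l : (Fin n → ℝ) →L[ℝ] ℝ := (-2 : ℝ) • ∑ j, ContinuousLinearMap.proj j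
  let F : (Fin n → ℝ) → ℝ := fun y =>
    2 * Real.log (vol ω y) + (l y + -2 * (n * Real.log (2 * Real.pi)))
  have hF : ContDiff ℝ 2 F :=
    (contDiff_const.mul (contDiff_log_vol hω h)).add (l.contDiff.add contDiff_const)
  have hdensity : logDensity (coordBasis n) (kahlerMetric ω) =ᶠ[𝓝 z] F ∘ logNorm := by
    filter_upwards [(isOpen_cstar n).mem_nhds hz] with y hy
    simp [logDensity_eq_log_vol hω h hy, F, l]
  rw [hω.isKahlerOn.ricci_eq_leviForm hz (coordBasis n), leviForm, hdensity.fderiv.fderiv_eq,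
    ← leviForm, leviForm_comp hF.contDiffAt (contDiffAt_logNorm hz), leviForm_logNorm hz,
    fderiv_fderiv_const_mul_add_affine (contDiff_log_vol hω h)]
  simp only [map_zero, add_zero, smul_apply, smul_eq_mul]
  ring

theorem ricci_expPoint (hω : IsKahlerForm ω) (h : IsHamiltonian ω) (x a b : Fin n → ℝ) :
    ricci (kahlerMetric ω) (expPoint x) (fun j => a j * expPoint x j)
      (fun j => b j * expPoint x j) =
      -fderiv ℝ (fderiv ℝ fun x => Real.log (vol ω x)) x a b := by
  have hx := expPoint_mem x
  have hradial (c : Fin n → ℝ) :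
      fderiv ℝ logNorm (expPoint x) (fun j => c j * expPoint x j) = c := by
    rw [fderiv_logNorm hx]
    ext j
    rw [mul_div_cancel_right₀ _ (hx j), Complex.ofReal_re]
  have hangular (c : Fin n → ℝ) :
      fderiv ℝ logNorm (expPoint x) (mulI n fun j => c j * expPoint x j) = 0 := by
    ext j
    simp [fderiv_logNorm hx, mulI_apply, ← mul_assoc, hx j]
  rw [ricci_eq_hessian_log_vol hω h hx, hradial, hradial, hangular, hangular, logNorm_expPoint,
    map_zero, add_zero]

theorem ricci_nonpos_iff_convexOn_log_vol (hω : IsKahlerForm ω) (h : IsHamiltonian ω) :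
    (∀ z ∈ cstar n, ∀ v, ricci (kahlerMetric ω) z v v ≤ 0) ↔
      ConvexOn ℝ Set.univ fun x => Real.log (vol ω x) := by
  rw [convexOn_univ_iff_hessian_nonneg (contDiff_log_vol hω h)]
  refine ⟨fun hric x a => ?_, fun hhess z hz v => ?_⟩
  · rw [← neg_nonpos, ← ricci_expPoint hω h]
    exact hric _ (expPoint_mem x) _
  · rw [ricci_eq_hessian_log_vol hω h hz]
    exact neg_nonpos.2 (add_nonneg (hhess _ _) (hhess _ _))

theorem ricci_nonneg_iff_concaveOn_log_vol (hω : IsKahlerForm ω) (h : IsHamiltonian ω) :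
    (∀ z ∈ cstar n, ∀ v, 0 ≤ ricci (kahlerMetric ω) z v v) ↔
      ConcaveOn ℝ Set.univ fun x => Real.log (vol ω x) := by
  rw [concaveOn_univ_iff_hessian_nonpos (contDiff_log_vol hω h)]
  refine ⟨fun hric x a => ?_, fun hhess z hz v => ?_⟩
  · rw [← neg_nonneg, ← ricci_expPoint hω h]
    exact hric _ (expPoint_mem x) _
  · rw [ricci_eq_hessian_log_vol hω h hz]
    exact neg_nonneg.2 (add_nonpos (hhess _ _) (hhess _ _))

theorem convexOn_vol_of_log (hω : IsKahlerForm ω) (h : IsHamiltonian ω)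
    (hlog : ConvexOn ℝ Set.univ fun x => Real.log (vol ω x)) : ConvexOn ℝ Set.univ (vol ω) := by
  simpa only [Real.exp_log (vol_pos hω h _)] using convexOn_exp_comp hlog

theorem convexOn_one_div_vol_of_log (hω : IsKahlerForm ω) (h : IsHamiltonian ω)
    (hlog : ConcaveOn ℝ Set.univ fun x => Real.log (vol ω x)) :
    ConvexOn ℝ Set.univ fun x => 1 / vol ω x := by
  simpa only [Pi.neg_apply, Real.exp_neg, Real.exp_log (vol_pos hω h _), one_div] using
    convexOn_exp_comp hlog.neg

theorem log_vol_eq_of_ricci_eq_zero (hω : IsKahlerForm ω) (h : IsHamiltonian ω)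
    (hric : ∀ z ∈ cstar n, ∀ v w, ricci (kahlerMetric ω) z v w = 0) (x : Fin n → ℝ) :
    Real.log (vol ω x) =
      Real.log (vol ω 0) + fderiv ℝ (fun x => Real.log (vol ω x)) 0 x := by
  refine eq_add_fderiv_of_hessian_eq_zero (contDiff_log_vol hω h) (fun y => ?_) x
  ext a b
  rw [← neg_inj, ← ricci_expPoint hω h, hric _ (expPoint_mem y)]
  simp

end OrbitSpace

end ToricKahler

theorem mainTheorem6 (n : ℕ) (ω : (Fin n → ℂ) → (Fin n → ℂ) [⋀^Fin 2]→L[ℝ] ℝ)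
    (hω : ToricKahler.IsKahlerForm ω) (hHam : ToricKahler.IsHamiltonian ω) :
    -- `H` is invariant under the torus
    (∀ t : Fin n → Circle, ∀ z ∈ ToricKahler.cstar n,
      ToricKahler.detH ω (ToricKahler.torusAct t z) = ToricKahler.detH ω z) ∧
    -- the volume is a positive function on the orbit space
    (∀ t : Fin n → Circle, ∀ z ∈ ToricKahler.cstar n,
      ToricKahler.orbitVolume ω (ToricKahler.torusAct t z) = ToricKahler.orbitVolume ω z) ∧
    (∀ x : Fin n → ℝ, 0 < ToricKahler.vol ω x) ∧
    -- nonpositive Ricci curvature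
    ((∀ z ∈ ToricKahler.cstar n, ∀ v : Fin n → ℂ,
        ToricKahler.ricci (ToricKahler.kahlerMetric ω) z v v ≤ 0) ↔
      ConvexOn ℝ Set.univ fun x => Real.log (ToricKahler.vol ω x)) ∧
    ((∀ z ∈ ToricKahler.cstar n, ∀ v : Fin n → ℂ,
        ToricKahler.ricci (ToricKahler.kahlerMetric ω) z v v ≤ 0) →
      ConvexOn ℝ Set.univ (ToricKahler.vol ω)) ∧
    -- nonnegative Ricci curvature
    ((∀ z ∈ ToricKahler.cstar n, ∀ v : Fin n → ℂ,
        0 ≤ ToricKahler.ricci (ToricKahler.kahlerMetric ω) z v v) ↔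
      ConcaveOn ℝ Set.univ fun x => Real.log (ToricKahler.vol ω x)) ∧
    ((∀ z ∈ ToricKahler.cstar n, ∀ v : Fin n → ℂ,
        0 ≤ ToricKahler.ricci (ToricKahler.kahlerMetric ω) z v v) →
      ConvexOn ℝ Set.univ fun x => 1 / ToricKahler.vol ω x) ∧
    -- zero Ricci curvature
    ((∀ z ∈ ToricKahler.cstar n, ∀ v w : Fin n → ℂ,
        ToricKahler.ricci (ToricKahler.kahlerMetric ω) z v w = 0) →
      (∃ A : (Fin n → ℝ) →ᵃ[ℝ] ℝ, ∀ x, Real.log (ToricKahler.vol ω x) = A x) ∧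
      ∀ x v : Fin n → ℝ, ∃ a : ℝ, ∀ s : ℝ,
        Real.log (ToricKahler.vol ω (x + s • v)) = Real.log (ToricKahler.vol ω x) + a * s ∧
        ToricKahler.vol ω (x + s • v) = ToricKahler.vol ω x * Real.exp (a * s)) := by
  open ToricKahler in
  have hlog (x : Fin n → ℝ) : Real.exp (Real.log (vol ω x)) = vol ω x :=
    Real.exp_log (vol_pos hω hHam x)
  have hconvex := ricci_nonpos_iff_convexOn_log_vol hω hHam
  have hconcave := ricci_nonneg_iff_concaveOn_log_vol hω hHam
  refine ⟨fun t z hz => hHam.detH_torusAct hz t, fun t z hz => hHam.orbitVolume_torusAct hz t,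
    vol_pos hω hHam, hconvex, fun hric => convexOn_vol_of_log hω hHam (hconvex.1 hric), hconcave,
    fun hric => convexOn_one_div_vol_of_log hω hHam (hconcave.1 hric), fun hric => ?_⟩
  let l := fderiv ℝ (fun x => Real.log (vol ω x)) 0
  have haffine := log_vol_eq_of_ricci_eq_zero hω hHam hric
  refine ⟨⟨l.toLinearMap.toAffineMap + AffineMap.const ℝ _ (Real.log (vol ω 0)), fun x => ?_⟩,
    fun x v => ⟨l v, fun s => ?_⟩⟩
  · rw [haffine x, add_comm]
    rfl
  · have hline : Real.log (vol ω (x + s • v)) = Real.log (vol ω x) + l v * s := by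
      rw [haffine, haffine x, map_add, map_smul, smul_eq_mul, mul_comm s, add_assoc]
    exact ⟨hline, by rw [← hlog, hline, Real.exp_add, hlog]⟩
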